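/- An FLS space is a Hausdorff topological space that is first-countable, Lindelöf and scattered (every nonempty subspace has an isolated point). For a topological space $X$ put $X^{(0)}=X$ and, for ordinals $\alpha>0$, $X^{(\alpha)}=\bigcap_{\xi<\alpha}(X^{(\xi)})^{(1)}$, where $Y^{(1)}$ is the set of non-isolated points of the space $Y$; the scattered height of a scattered space $X$ is the least ordinal $\alpha$ with $X^{(\alpha)}=\emptyset$. A $\mathcal K$-Lusin set is a set $L\subseteq\omega^\omega$ such that $K\cap L$ is countable for every compact $K\subseteq\omega^\omega$. Let $\mathfrak c$ be the cardinality of the continuum and let $\mathfrak d$ be the dominating number, i.e. the least cardinality of a set $D\subseteq\omega^\omega$ such that for every $f\in\omega^\omega$ there is $g\in D$ with $f(n)\le g(n)$ for all but finitely many $n$. For an ordinal $\lambda$, let $\lim\lambda$ denote its limit part: the unique ordinal $\mu$ that is not a successor (so $\mu=0$ is allowed) with $\lambda=\mu+n$ for some $n<\omega$. Cofinality is denoted $\mathsf{cf}$, with $\mathsf{cf}(0)=0$ and $\mathsf{cf}(\alpha+1)=1$. Suppose that there exists a $\mathcal K$-Lusin set of cardinality $\mathfrak d$. Then for every ordinal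 $\lambda$ the following conditions are equivalent: 1. $\lambda$ is equal to the scattered height of some uncountable FLS space; 2. $2\le\lambda<\mathfrak c^+$, $\mathsf{cf}(\lambda)\le\omega$ and $\mathsf{cf}(\lim\lambda)\le\mathfrak d$. -/

import Mathlib

open scoped Cardinal Ordinal CantorBendixson

universe u

/-- A topological space is *scattered* if every nonempty subspace has an isolated point. -/
def IsScatteredSpace (X : Type u) [TopologicalSpace X] : Prop :=
  ∀ S : Set X, S.Nonempty → ∃ x ∈ S, ∃ U : Set X, IsOpen U ∧ U ∩ S = {x}

/-- An *FLS* space: a first-countable Lindelöf scattered Hausdorff space. -/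
structure IsFLSSpace (X : Type u) [TopologicalSpace X] : Prop where
  hausdorff : T2Space X
  firstCountable : FirstCountableTopology X
  lindelof : LindelofSpace X
  scattered : IsScatteredSpace X

/-- The *scattered height* of a scattered space `X`: the least ordinal `α` such that the
`α`-th Cantor-Bendixson derivative of `X` is empty. -/
noncomputable def scatteredHeight (X : Type u) [TopologicalSpace X] : Ordinal.{u} :=
  sInf {a : Ordinal.{u} | (Set.univ : Set X)ᵈ[a] = ∅}

/-- Every point of a scattered space has a Cantor-Bendixson height, and the set of heights of
points is exactly the set of ordinals below `scatteredHeight X`. -/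
theorem lt_scatteredHeight_iff {X : Type u} [TopologicalSpace X] (hX : IsScatteredSpace X)
    (a : Ordinal.{u}) :
    a < scatteredHeight X ↔
      ∃ x : X, x ∈ (Set.univ : Set X)ᵈ[a] ∧ x ∉ (Set.univ : Set X)ᵈ[a + 1] := by
  have key : ∀ b : Ordinal.{u}, (Set.univ : Set X)ᵈ[b].Nonempty →
      ∃ x : X, x ∈ (Set.univ : Set X)ᵈ[b] ∧ x ∉ (Set.univ : Set X)ᵈ[b + 1] := by
    intro b hb
    obtain ⟨x, hx, U, hU, hUS⟩ := hX _ hb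
    refine ⟨x, hx, fun h => ?_⟩
    rw [CantorBendixson.iteratedDerivedSet_succ, relDerivedSet_apply] at h
    have hacc := h.1
    rw [mem_derivedSet, accPt_iff_nhds] at hacc
    have hxU : x ∈ U := by
      have : x ∈ U ∩ (Set.univ : Set X)ᵈ[b] := by rw [hUS]; rfl
      exact this.1
    obtain ⟨y, hy, hne⟩ := hacc U (hU.mem_nhds hxU)
    rw [hUS] at hy
    exact hne hy
  have hne : {b : Ordinal.{u} | (Set.univ : Set X)ᵈ[b] = ∅}.Nonempty := by
    obtain ⟨b, hb⟩ := CantorBendixson.iteratedDerivedSet_mem_fixedPoints (Set.univ : Set X)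
    refine ⟨b, ?_⟩
    by_contra hcon
    obtain ⟨x, hx, hx'⟩ := key b (Set.nonempty_iff_ne_empty.2 hcon)
    rw [CantorBendixson.iteratedDerivedSet_succ, Function.mem_fixedPoints_iff.1 hb] at hx'
    exact hx' hx
  constructor
  · intro h
    exact key a (Set.nonempty_iff_ne_empty.2 fun h0 => notMem_of_lt_csInf' h h0)
  · rintro ⟨x, hx, -⟩
    by_contra hcon
    have h0 : (Set.univ : Set X)ᵈ[scatteredHeight X] = ∅ := csInf_mem hne
    have := CantorBendixson.iteratedDerivedSet_antitone (Set.univ : Set X) (not_lt.1 hcon) hx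
    rw [h0] at this
    exact this

/-- A *`𝒦`-Lusin set* is a subset of the Baire space `ω^ω` (with the product topology) whose
intersection with every compact set is countable. -/
def IsKLusin (L : Set (ℕ → ℕ)) : Prop :=
  ∀ K : Set (ℕ → ℕ), IsCompact K → (K ∩ L).Countable

/-- A family `D` in `ω^ω` is *dominating* if every `f` satisfies `f ≤* g` for some `g ∈ D`. -/
def IsDominating (D : Set (ℕ → ℕ)) : Prop :=
  ∀ f : ℕ → ℕ, ∃ g ∈ D, ∀ᶠ n in Filter.cofinite, f n ≤ g n

/-- The *dominating number* `𝔡`. -/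
noncomputable def dominatingNumber : Cardinal.{0} :=
  sInf {c : Cardinal.{0} | ∃ D : Set (ℕ → ℕ), IsDominating D ∧ #D = c}

/-- The *limit part* of an ordinal `a`, where `0` counts as a limit ordinal. -/
noncomputable def limitPart (a : Ordinal.{u}) : Ordinal.{u} := ω * (a / ω)

/-- `limitPart a` is the unique `b` that is not a successor with `a = b + n` for a finite `n`. -/
theorem eq_limitPart_iff (a b : Ordinal.{u}) :
    b = limitPart a ↔ (∀ c : Ordinal.{u}, b ≠ c + 1) ∧ ∃ n : ℕ, a = b + n := by
  have hmul : ∀ d c : Ordinal.{u}, ω * d ≠ c + 1 := by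
    intro d c h
    rcases eq_or_ne d 0 with rfl | hd
    · rw [mul_zero] at h
      have := lt_add_one c
      rw [← h] at this
      exact not_lt_bot this
    · have hl : Order.IsSuccLimit (ω * d) :=
        Ordinal.isSuccLimit_mul_left Ordinal.isSuccLimit_omega0 (pos_iff_ne_zero.2 hd)
      have := hl.succ_lt (a := c) (by rw [h]; exact lt_add_one c)
      rw [h, Order.succ_eq_add_one] at this
      exact lt_irrefl _ this
  constructor
  · rintro rfl
    refine ⟨hmul _, ?_⟩
    obtain ⟨n, hn⟩ := Ordinal.lt_omega0.1 (Ordinal.mod_lt a Ordinal.omega0_ne_zero)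
    exact ⟨n, by rw [← hn, limitPart, Ordinal.div_add_mod]⟩
  · rintro ⟨hb, n, rfl⟩
    obtain ⟨m, hm⟩ := Ordinal.lt_omega0.1 (Ordinal.mod_lt b Ordinal.omega0_ne_zero)
    have hb' : b = ω * (b / ω) + m := by rw [← hm, Ordinal.div_add_mod]
    have hm0 : m = 0 := by
      cases m with
      | zero => rfl
      | succ k =>
        rw [Nat.cast_succ, ← add_assoc] at hb'
        exact absurd hb' (hb _)
    rw [hm0, Nat.cast_zero, add_zero] at hb'
    have h2 : (b + n) / ω = b / ω := by
      conv_lhs => rw [hb']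
      rw [Ordinal.mul_add_div _ Ordinal.omega0_ne_zero,
        Ordinal.div_eq_zero_of_lt (Ordinal.natCast_lt_omega0 n), add_zero]
    rw [limitPart, h2]
    exact hb'

/-!
For necessity, let `X` be an uncountable FLS space. Arhangel'skii's theorem bounds its cardinality,
hence its height, and Lindelöfness makes the height have countable cofinality
(`cof_scatteredHeight_le`). Let the height be `m + n` with `n` finite and `m` the limit part. Each
set `Xᵈ[m + k]` is an intersection of at most `𝔡` open sets, by downward induction on `k`: outside
an open set around `Xᵈ[m + k + 1]` it is countable, and a countable set is an intersection of `𝔡`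
open sets because a dominating family controls how fast its points are approached. So the
complement of `Xᵈ[m]` is a union of `𝔡` closed sets. If `m` had cofinality above `𝔡`, hence
uncountable, each of them would miss a derived set of level below `m`
(`exists_disjoint_iteratedDerivedSet`), and all of them together the same one, which is absurd
(`cof_le_of_scatteredHeight_eq_add`).

For sufficiency there are three constructions.

* Limit heights `l < 𝔠⁺` of countable cofinality need no hypothesis. Partition the real line into
  Bernstein sets indexed by the ordinals below `l`, and let a neighbourhood of a point of rank `a`
  keep only the points of smaller rank (`RankRefinement`). Neighbourhoods of all the points of one
  rank cover all but countably many of the points of smaller rank, because the closed set that they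
  omit misses a Bernstein set. This makes the space Lindelöf.
* A `𝒦`-Lusin set, with its points replaced by FLS spaces, can be completed to an FLS space by
  attaching the finite sequences as limit points (`lusinGluing`): the points outside a neighbourhood
  of the set of finite sequences lie in a compact set. Replacing points by points gives the height
  `2`; replacing them by spaces of heights cofinal in `m`, where `ℵ₀ < cof m ≤ 𝔡`, gives `m + 1`,
  since the height `m` itself is excluded by its cofinality.
* A sequence of copies of a space converging to one new point raises the height by one.
-/

/-! ### Iterated derived sets of a space and ranks of its points -/

section Derived

variable {X : Type u} [TopologicalSpace X]

theorem mem_iteratedDerivedSet_add_one {a : Ordinal.{u}} {x : X} :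
    x ∈ (Set.univ : Set X)ᵈ[a + 1] ↔ x ∈ (Set.univ : Set X)ᵈ[a] ∧
      ∀ U : Set X, IsOpen U → x ∈ U → ∃ y ∈ U, y ∈ (Set.univ : Set X)ᵈ[a] ∧ y ≠ x := by
  rw [CantorBendixson.iteratedDerivedSet_succ, relDerivedSet_apply, Set.mem_inter_iff,
    mem_derivedSet, accPt_iff_nhds, and_comm]
  refine and_congr_right fun _ => ⟨fun h U hU hx => ?_, fun h V hV => ?_⟩
  · obtain ⟨y, hy, hne⟩ := h U (hU.mem_nhds hx)
    exact ⟨y, hy.1, hy.2, hne⟩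
  · obtain ⟨U, hUV, hU, hx⟩ := mem_nhds_iff.1 hV
    obtain ⟨y, hy, hy', hne⟩ := h U hU hx
    exact ⟨y, ⟨hUV hy, hy'⟩, hne⟩

theorem isClosed_iteratedDerivedSet_univ (a : Ordinal.{u}) :
    IsClosed (Set.univ : Set X)ᵈ[a] :=
  CantorBendixson.isClosed_iteratedDerivedSet isClosed_univ a

theorem mem_iteratedDerivedSet_limit {a : Ordinal.{u}} (ha : Order.IsSuccLimit a) {x : X} :
    x ∈ (Set.univ : Set X)ᵈ[a] ↔ ∀ b < a, x ∈ (Set.univ : Set X)ᵈ[b] := by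
  rw [CantorBendixson.iteratedDerivedSet_limit ha]
  simp

theorem lt_scatteredHeight_iff_nonempty (hX : IsScatteredSpace X) {a : Ordinal.{u}} :
    a < scatteredHeight X ↔ ((Set.univ : Set X)ᵈ[a]).Nonempty := by
  refine ⟨fun h => ?_, fun ⟨x, hx⟩ => ?_⟩
  · obtain ⟨x, hx, -⟩ := (lt_scatteredHeight_iff hX a).1 h
    exact ⟨x, hx⟩
  · obtain ⟨y, hy, U, hU, hUS⟩ := hX _ ⟨x, hx⟩
    refine (lt_scatteredHeight_iff hX a).2 ⟨y, hy, fun h => ?_⟩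
    have hyU : y ∈ U := (hUS.ge rfl : y ∈ U ∩ (Set.univ : Set X)ᵈ[a]).1
    obtain ⟨z, hz, hz', hne⟩ := (mem_iteratedDerivedSet_add_one.1 h).2 U hU hyU
    exact hne (hUS.le ⟨hz, hz'⟩)

theorem iteratedDerivedSet_eq_empty (hX : IsScatteredSpace X) {a : Ordinal.{u}}
    (ha : scatteredHeight X ≤ a) : (Set.univ : Set X)ᵈ[a] = ∅ := by
  by_contra h
  exact ha.not_gt ((lt_scatteredHeight_iff_nonempty hX).2 (Set.nonempty_iff_ne_empty.2 h))

/-- A function into the ordinals of which every point is a strict local maximum witnesses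
scatteredness. -/
theorem isScatteredSpace_of_rank {r : X → Ordinal.{u}}
    (h : ∀ x, ∃ U, IsOpen U ∧ x ∈ U ∧ ∀ y ∈ U, y ≠ x → r y < r x) : IsScatteredSpace X := by
  intro S hS
  obtain ⟨x, hx, hmin⟩ := WellFounded.has_min (InvImage.wf r Ordinal.lt_wf) S hS
  obtain ⟨U, hU, hxU, hlt⟩ := h x
  refine ⟨x, hx, U, hU, Set.Subset.antisymm ?_ ?_⟩
  · rintro y ⟨hyU, hyS⟩
    by_contra hne
    exact hmin y hyS (hlt y hyU hne)
  · rintro y rfl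
    exact ⟨hxU, hx⟩

theorem le_rank_of_mem_iteratedDerivedSet {r : X → Ordinal.{u}}
    (h : ∀ x, ∃ U, IsOpen U ∧ x ∈ U ∧ ∀ y ∈ U, y ≠ x → r y < r x) (a : Ordinal.{u}) :
    ∀ x ∈ (Set.univ : Set X)ᵈ[a], a ≤ r x := by
  induction a using Ordinal.limitRecOn with
  | zero => exact fun x _ => zero_le
  | add_one a ih =>
    intro x hx
    obtain ⟨U, hU, hxU, hlt⟩ := h x
    obtain ⟨y, hyU, hy, hne⟩ := (mem_iteratedDerivedSet_add_one.1 hx).2 U hU hxU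
    exact Order.add_one_le_of_lt ((ih y hy).trans_lt (hlt y hyU hne))
  | limit a ha ih =>
    intro x hx
    refine le_of_forall_lt fun b hb => ?_
    exact Order.add_one_le_iff.1 (ih _ (ha.add_one_lt hb) x
      ((mem_iteratedDerivedSet_limit ha).1 hx _ (ha.add_one_lt hb)))

theorem scatteredHeight_le_of_rank {r : X → Ordinal.{u}}
    (h : ∀ x, ∃ U, IsOpen U ∧ x ∈ U ∧ ∀ y ∈ U, y ≠ x → r y < r x) {l : Ordinal.{u}}
    (hl : ∀ x, r x < l) : scatteredHeight X ≤ l := by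
  by_contra! hlt
  obtain ⟨x, hx⟩ := (lt_scatteredHeight_iff_nonempty (isScatteredSpace_of_rank h)).1 hlt
  exact (hl x).not_ge (le_rank_of_mem_iteratedDerivedSet h l x hx)

/-- If every neighbourhood of `x` contains points of all ranks below that of `x`, then the rank
bounds the Cantor-Bendixson height from below. -/
theorem mem_iteratedDerivedSet_of_le_rank {r : X → Ordinal.{u}}
    (h : ∀ x U, IsOpen U → x ∈ U → ∀ b < r x, ∃ y ∈ U, r y = b) (a : Ordinal.{u}) :
    ∀ x, a ≤ r x → x ∈ (Set.univ : Set X)ᵈ[a] := by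
  induction a using Ordinal.limitRecOn with
  | zero => simp
  | add_one a ih =>
    intro x hx
    have hax := Order.add_one_le_iff.1 hx
    refine mem_iteratedDerivedSet_add_one.2 ⟨ih x hax.le, fun U hU hxU => ?_⟩
    obtain ⟨y, hyU, hy⟩ := h x U hU hxU a hax
    exact ⟨y, hyU, ih y hy.ge, fun hne => hax.ne (hne ▸ hy).symm⟩
  | limit a ha ih =>
    exact fun x hx => (mem_iteratedDerivedSet_limit ha).2 fun b hb => ih b hb x (hb.le.trans hx)

theorem map_mem_iteratedDerivedSet {Y : Type u} [TopologicalSpace Y] {f : Y → X}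
    (hf : Continuous f) (hinj : Function.Injective f) (a : Ordinal.{u}) :
    ∀ y ∈ (Set.univ : Set Y)ᵈ[a], f y ∈ (Set.univ : Set X)ᵈ[a] := by
  induction a using Ordinal.limitRecOn with
  | zero => simp
  | add_one a ih =>
    intro y hy
    rw [mem_iteratedDerivedSet_add_one] at hy ⊢
    refine ⟨ih y hy.1, fun U hU hyU => ?_⟩
    obtain ⟨z, hzU, hz, hne⟩ := hy.2 _ (hU.preimage hf) hyU
    exact ⟨f z, hzU, ih z hz, fun h => hne (hinj h)⟩
  | limit a ha ih =>
    intro y hy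
    rw [mem_iteratedDerivedSet_limit ha] at hy ⊢
    exact fun b hb => ih b hb y (hy b hb)

theorem scatteredHeight_le_of_injective {Y : Type u} [TopologicalSpace Y]
    (hY : IsScatteredSpace Y) (hX : IsScatteredSpace X) {f : Y → X}
    (hf : Continuous f) (hinj : Function.Injective f) : scatteredHeight Y ≤ scatteredHeight X := by
  refine le_of_forall_lt fun a ha => ?_
  obtain ⟨y, hy⟩ := (lt_scatteredHeight_iff_nonempty hY).1 ha
  exact (lt_scatteredHeight_iff_nonempty hX).2 ⟨f y, map_mem_iteratedDerivedSet hf hinj a y hy⟩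

end Derived

/-! ### Cardinality of first-countable Lindelöf spaces -/

/-- Every set operation of countable arity, taken from a family of at most continuum many, has a
nonempty invariant set of cardinality at most the continuum: the values of the well-founded terms
built from one constant and the given operations. -/
theorem exists_closed_under_operations {X : Type u} (x₀ : X) {I : Type}
    (hI : #I ≤ Cardinal.continuum) (op : I → (ℕ → X) → X) :
    ∃ A : Set X, x₀ ∈ A ∧ #A ≤ Cardinal.continuum ∧
      ∀ i (s : ℕ → X), (∀ n, s n ∈ A) → op i s ∈ A := by
  let β : Option I → Type := fun o => o.elim Empty fun _ => ℕ
  let ev : WType β → X := WType.elim X fun p => match p with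
    | ⟨none, _⟩ => x₀
    | ⟨some i, s⟩ => op i s
  have hW : #(WType β) ≤ Cardinal.continuum := by
    refine WType.cardinalMk_le_of_le ?_
    refine (Cardinal.sum_le_sum _ (fun _ => Cardinal.continuum) fun o => ?_).trans ?_
    · cases o with
      | none => simpa [β] using Cardinal.one_le_aleph0.trans Cardinal.aleph0_le_continuum
      | some i => simp [β]
    · rw [Cardinal.sum_const, Cardinal.mk_option, Cardinal.lift_id, Cardinal.lift_id]
      refine (mul_le_mul_left (add_le_add hI (Cardinal.one_le_aleph0.trans
        Cardinal.aleph0_le_continuum)) _).trans ?_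
      simp
  refine ⟨Set.range ev, ⟨WType.mk none Empty.elim, rfl⟩, ?_, fun i s hs => ?_⟩
  · have h := Cardinal.mk_range_le_lift (f := ev)
    rw [Cardinal.lift_id'.{0, u}] at h
    refine h.trans ((Cardinal.lift_le.2 hW).trans (by simp))
  · choose w hw using hs
    exact ⟨WType.mk (some i) w, by simp only [ev, WType.elim]; congr 1; exact funext hw⟩

/-- **Arhangel'skii's theorem** for first-countable Lindelöf Hausdorff spaces. -/
theorem mk_le_continuum_of_lindelof (X : Type u) [TopologicalSpace X] [T2Space X]
    [FirstCountableTopology X] [LindelofSpace X] : #X ≤ Cardinal.continuum := by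
  classical
  rcases isEmpty_or_nonempty X with hX | ⟨⟨x₀⟩⟩
  · simp
  have hb : ∀ x : X, ∃ B : ℕ → Set X, (∀ n, x ∈ B n ∧ IsOpen (B n)) ∧
      (nhds x).HasBasis (fun _ => True) B := by
    intro x
    obtain ⟨B, hB⟩ := (nhds_basis_opens x).exists_antitone_subbasis
    exact ⟨B, hB.1, hB.2.toHasBasis⟩
  choose B hB hbasis using hb
  -- One operation takes limits; for each `f`, another one leaves the union of the `B (s n) (f n)`.
  let op : Option (ℕ → ℕ) → (ℕ → X) → X := fun o s => match o with
    | none => if h : ∃ x, Filter.Tendsto s Filter.atTop (nhds x) then h.choose else x₀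
    | some f => if h : ∃ x, x ∉ ⋃ n, B (s n) (f n) then h.choose else x₀
  have hI : #(Option (ℕ → ℕ)) ≤ Cardinal.continuum := by
    rw [Cardinal.mk_option]
    exact Cardinal.add_le_of_le Cardinal.aleph0_le_continuum (by simp)
      (Cardinal.one_le_aleph0.trans Cardinal.aleph0_le_continuum)
  obtain ⟨A, hx₀, hA, hop⟩ := exists_closed_under_operations x₀ hI op
  have hclosed : IsClosed A := by
    refine isClosed_of_closure_subset fun x hx => ?_
    obtain ⟨s, hs, hsx⟩ := mem_closure_iff_seq_limit.1 hx
    have hex : ∃ x, Filter.Tendsto s Filter.atTop (nhds x) := ⟨x, hsx⟩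
    have h := hop none s hs
    simp only [op, dif_pos hex] at h
    rwa [tendsto_nhds_unique hex.choose_spec hsx] at h
  suffices hU : A = Set.univ by rwa [hU, Cardinal.mk_univ] at hA
  refine Set.eq_univ_of_forall fun p => ?_
  by_contra hp
  have hn : ∀ a : X, ∃ n, a ∈ A → p ∉ B a n := by
    intro a
    by_cases ha : a ∈ A
    · have hne : a ≠ p := fun h => hp (h ▸ ha)
      obtain ⟨n, -, hn⟩ := (hbasis a).mem_iff.1 (isOpen_compl_singleton.mem_nhds
        (show a ∈ ({p} : Set X)ᶜ from hne))
      exact ⟨n, fun _ h => hn h rfl⟩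
    · exact ⟨0, fun h => absurd h ha⟩
  choose f hf using hn
  obtain ⟨t, htA, ht, hcov⟩ := hclosed.isLindelof.elim_nhds_subcover (fun a => B a (f a))
    fun a _ => (hbasis a).mem_of_mem trivial
  have htne : t.Nonempty := by
    obtain ⟨a, ha, -⟩ := Set.mem_iUnion₂.1 (hcov hx₀)
    exact ⟨a, ha⟩
  obtain ⟨s, rfl⟩ := htA.exists_eq_range htne
  have hs : ∀ n, s n ∈ A := fun n => ht _ ⟨n, rfl⟩
  have hex : ∃ x, x ∉ ⋃ n, B (s n) (f (s n)) := by
    refine ⟨p, fun h => ?_⟩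
    obtain ⟨n, hn⟩ := Set.mem_iUnion.1 h
    exact hf _ (hs n) hn
  have h := hop (some fun n => f (s n)) s hs
  simp only [op, dif_pos hex] at h
  refine hex.choose_spec ?_
  obtain ⟨a, ⟨n, rfl⟩, hn⟩ := Set.mem_iUnion₂.1 (hcov h)
  exact Set.mem_iUnion.2 ⟨n, hn⟩

theorem card_scatteredHeight_le {X : Type u} [TopologicalSpace X] (hX : IsScatteredSpace X) :
    (scatteredHeight X).card ≤ #X := by
  have h : ∀ a : (scatteredHeight X).ToType, ∃ x : X,
      x ∈ (Set.univ : Set X)ᵈ[(Ordinal.ToType.mk.symm a : Ordinal)] ∧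
      x ∉ (Set.univ : Set X)ᵈ[(Ordinal.ToType.mk.symm a : Ordinal) + 1] := fun a =>
    (lt_scatteredHeight_iff hX _).1 (Ordinal.ToType.mk.symm a).2
  choose f hf hf' using h
  rw [← Cardinal.mk_toType]
  refine Cardinal.mk_le_of_injective (f := f) fun a b hab => ?_
  have key : ∀ a b, f a = f b →
      (Ordinal.ToType.mk.symm a : Ordinal) ≤ Ordinal.ToType.mk.symm b := by
    intro a b hab
    by_contra! hlt
    exact hf' b (hab ▸ CantorBendixson.iteratedDerivedSet_antitone _
      (Order.add_one_le_of_lt hlt) (hf a))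
  exact Ordinal.ToType.mk.symm.injective
    (Subtype.ext ((key a b hab).antisymm (key b a hab.symm)))

/-! ### The dominating number -/

theorem exists_isDominating_mk_eq : ∃ D : Set (ℕ → ℕ), IsDominating D ∧ #D = dominatingNumber :=
  csInf_mem (s := {c : Cardinal.{0} | ∃ D : Set (ℕ → ℕ), IsDominating D ∧ #D = c})
    ⟨_, Set.univ, fun f => ⟨f, trivial, .of_forall fun _ => le_rfl⟩, rfl⟩

theorem aleph0_lt_dominatingNumber : Cardinal.aleph0 < dominatingNumber := by
  obtain ⟨D, hD, hc⟩ := exists_isDominating_mk_eq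
  rw [← hc, ← not_le, Cardinal.le_aleph0_iff_set_countable]
  intro hcount
  obtain ⟨g, hg, -⟩ := hD 0
  obtain ⟨e, rfl⟩ := hcount.exists_eq_range ⟨g, hg⟩
  -- Diagonalize: this function exceeds `e i` at every `n ≥ i`.
  obtain ⟨_, ⟨i, rfl⟩, hi⟩ := hD fun n => (∑ i ∈ Finset.range (n + 1), e i n) + 1
  rw [Nat.cofinite_eq_atTop] at hi
  obtain ⟨n, hn, hin⟩ := (hi.and (Filter.eventually_ge_atTop i)).exists
  have : e i n ≤ ∑ i ∈ Finset.range (n + 1), e i n :=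
    Finset.single_le_sum (f := fun i => e i n) (fun _ _ => Nat.zero_le _) (Finset.mem_range.2 (Nat.lt_succ_of_le hin))
  omega

/-- Closing a dominating family under finite modifications makes it dominate everywhere. -/
theorem exists_everywhere_dominating : ∃ (I : Type) (F : I → ℕ → ℕ),
    #I ≤ dominatingNumber ∧ ∀ f : ℕ → ℕ, ∃ i, f ≤ F i := by
  obtain ⟨D, hD, hc⟩ := exists_isDominating_mk_eq
  refine ⟨D × ℕ, fun p n => max (p.1.1 n) p.2, ?_, fun f => ?_⟩
  · rw [Cardinal.mk_prod, Cardinal.lift_id, Cardinal.lift_id, hc, Cardinal.mk_nat]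
    exact (Cardinal.mul_eq_left aleph0_lt_dominatingNumber.le aleph0_lt_dominatingNumber.le
      Cardinal.aleph0_ne_zero).le
  · obtain ⟨g, hg, hfg⟩ := hD f
    have hfin : {n | ¬ f n ≤ g n}.Finite := hfg
    obtain ⟨m, hm⟩ := (hfin.image f).bddAbove
    refine ⟨(⟨g, hg⟩, m), fun n => ?_⟩
    by_cases h : f n ≤ g n
    · exact h.trans (le_max_left _ _)
    · exact (hm ⟨n, h, rfl⟩).trans (le_max_right _ _)

/-! ### Necessary conditions on the scattered height -/

section Necessary

variable {X : Type u} [TopologicalSpace X]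

theorem exists_bound_of_lift_mk_lt_cof {I : Type} {m : Ordinal.{u}}
    (hI : Cardinal.lift.{u} #I < m.cof) (g : I → Ordinal.{u}) (hg : ∀ i, g i < m) :
    ∃ b < m, ∀ i, g i ≤ b :=
  ⟨⨆ i, g i, Ordinal.lift_iSup_lt_of_lt_cof (by simpa using hI) hg,
    fun i => Ordinal.le_iSup g i⟩

/-- A closed subset of a Lindelöf space which misses a derived set of level of uncountable
cofinality already misses a derived set of smaller level. -/
theorem exists_disjoint_iteratedDerivedSet [LindelofSpace X] {m : Ordinal.{u}}
    (hm : Cardinal.aleph0 < m.cof) {K : Set X} (hK : IsClosed K)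
    (hdisj : Disjoint K (Set.univ : Set X)ᵈ[m]) :
    ∃ b < m, Disjoint K (Set.univ : Set X)ᵈ[b] := by
  have hlim : Order.IsSuccLimit m := Ordinal.one_lt_cof_iff.1 (Cardinal.one_lt_aleph0.trans hm)
  obtain ⟨r, hr, hcov⟩ := hK.isLindelof.elim_countable_subcover
    (fun a : Set.Iio m => ((Set.univ : Set X)ᵈ[(a : Ordinal)])ᶜ)
    (fun a => (isClosed_iteratedDerivedSet_univ _).isOpen_compl) fun x hx => by
      have := Set.disjoint_left.1 hdisj hx
      rw [mem_iteratedDerivedSet_limit hlim] at this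
      push Not at this
      obtain ⟨b, hb, hxb⟩ := this
      exact Set.mem_iUnion.2 ⟨⟨b, hb⟩, hxb⟩
  rcases r.eq_empty_or_nonempty with rfl | hne
  · refine ⟨0, hlim.bot_lt, ?_⟩
    have : K = ∅ := by simpa using hcov
    simp [this]
  obtain ⟨e, rfl⟩ := hr.exists_eq_range hne
  obtain ⟨b, hb, hle⟩ := exists_bound_of_lift_mk_lt_cof (I := ℕ) (by simpa using hm)
    (fun n => (e n : Ordinal)) fun n => (e n).2
  refine ⟨b, hb, Set.disjoint_left.2 fun x hx hxb => ?_⟩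
  obtain ⟨_, ⟨n, rfl⟩, hn⟩ := Set.mem_iUnion₂.1 (hcov hx)
  exact hn (CantorBendixson.iteratedDerivedSet_antitone _ (hle n) hxb)

theorem cof_scatteredHeight_le [LindelofSpace X] (hX : IsScatteredSpace X) :
    (scatteredHeight X).cof ≤ Cardinal.aleph0 := by
  by_contra! h
  obtain ⟨b, hb, hdisj⟩ := exists_disjoint_iteratedDerivedSet h (isClosed_univ (X := X))
    (by rw [iteratedDerivedSet_eq_empty hX le_rfl]; exact Set.disjoint_empty _)
  obtain ⟨x, hx⟩ := (lt_scatteredHeight_iff_nonempty hX).1 hb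
  exact Set.disjoint_left.1 hdisj trivial hx

theorem countable_of_isClosed_of_isolated [LindelofSpace X] {C : Set X} (hC : IsClosed C)
    (h : ∀ x ∈ C, ∃ U, IsOpen U ∧ U ∩ C = {x}) : C.Countable := by
  choose! U hU hUC using h
  have hmem : ∀ x ∈ C, x ∈ U x := fun x hx => ((hUC x hx).ge rfl : x ∈ U x ∩ C).1
  obtain ⟨t, ht, htc, hcov⟩ := hC.isLindelof.elim_nhds_subcover U
    fun x hx => (hU x hx).mem_nhds (hmem x hx)
  refine ht.mono fun x hx => ?_
  obtain ⟨y, hy, hxy⟩ := Set.mem_iUnion₂.1 (hcov hx)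
  have : x = y := (hUC y (htc y hy)).le ⟨hxy, hx⟩
  exact this ▸ hy

theorem two_le_scatteredHeight [LindelofSpace X] (hX : IsScatteredSpace X) [Uncountable X] :
    2 ≤ scatteredHeight X := by
  rw [← one_add_one_eq_two, Order.add_one_le_iff]
  by_contra! h
  refine not_countable_iff.2 ‹Uncountable X› (Set.countable_univ_iff.1
    (countable_of_isClosed_of_isolated isClosed_univ fun x _ => ?_))
  have hx : x ∉ (Set.univ : Set X)ᵈ[(0 : Ordinal.{u}) + 1] := by
    rw [zero_add, iteratedDerivedSet_eq_empty hX h]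
    exact id
  rw [mem_iteratedDerivedSet_add_one] at hx
  simp only [CantorBendixson.iteratedDerivedSet_zero, Set.mem_univ, true_and] at hx
  push Not at hx
  obtain ⟨U, hU, hxU, hUx⟩ := hx
  exact ⟨U, hU, by rw [Set.inter_univ]; exact Set.Subset.antisymm hUx (by simpa)⟩

/-- `F` is the intersection of at most `𝔡` open sets. -/
def HasSmallPseudocharacter (F : Set X) : Prop :=
  ∃ (J : Type) (U : J → Set X), #J ≤ dominatingNumber ∧ (∀ j, IsOpen (U j)) ∧ (∀ j, F ⊆ U j) ∧
    ∀ y ∉ F, ∃ j, y ∉ U j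

/-- One index type serves all countable sets `C = {x k | k}`: with `B k` a decreasing neighbourhood
base at `x k` and `F` an everywhere dominating family, the unions of the `B k (F i k)` over `k`
have intersection `C`. -/
theorem exists_common_index [T1Space X] [FirstCountableTopology X] :
    ∃ I : Type, #I ≤ dominatingNumber ∧ ∀ C : Set X, C.Countable → ∃ U : I → Set X,
      (∀ i, IsOpen (U i)) ∧ (∀ i, C ⊆ U i) ∧ ∀ y ∉ C, ∃ i, y ∉ U i := by
  obtain ⟨I, F, hI, hF⟩ := exists_everywhere_dominating
  refine ⟨I, hI, fun C hC => ?_⟩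
  rcases C.eq_empty_or_nonempty with rfl | hne
  · obtain ⟨i, -⟩ := hF 0
    exact ⟨fun _ => ∅, fun _ => isOpen_empty, fun _ => le_rfl, fun _ _ => ⟨i, id⟩⟩
  obtain ⟨x, rfl⟩ := hC.exists_eq_range hne
  choose B hB using fun k => (nhds_basis_opens (x k)).exists_antitone_subbasis
  refine ⟨fun i => ⋃ k, B k (F i k), fun i => isOpen_iUnion fun k => ((hB k).1 _).2, ?_, ?_⟩
  · rintro i _ ⟨k, rfl⟩
    exact Set.mem_iUnion.2 ⟨k, ((hB k).1 _).1⟩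
  · intro y hy
    have h : ∀ k, ∃ n, y ∉ B k n := by
      intro k
      obtain ⟨n, -, hn⟩ := (hB k).2.toHasBasis.mem_iff.1 (isOpen_compl_singleton.mem_nhds
        (show x k ∈ ({y} : Set X)ᶜ from fun h => hy ⟨k, h⟩))
      exact ⟨n, fun h => hn h rfl⟩
    choose f hf using h
    obtain ⟨i, hi⟩ := hF f
    refine ⟨i, fun hyi => ?_⟩
    obtain ⟨k, hk⟩ := Set.mem_iUnion.1 hyi
    exact hf k ((hB k).2.antitone (hi k) hk)

/-- If `G` is the set of accumulation points of the closed set `F` within `F` and `U` is open with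
`G ⊆ U`, then `F \ U` is closed and discrete, hence countable. So a family of open sets for `G`
and the families for the countable sets `F \ U` combine into a family for `F`. -/
theorem HasSmallPseudocharacter.of_derived [T1Space X] [FirstCountableTopology X]
    [LindelofSpace X] {F G : Set X} (hF : IsClosed F)
    (hiso : ∀ x ∈ F, x ∉ G → ∃ V, IsOpen V ∧ V ∩ F = {x}) (hGF : G ⊆ F)
    (hG : HasSmallPseudocharacter G) : HasSmallPseudocharacter F := by
  obtain ⟨J, U, hJ, hU, hGU, hyU⟩ := hG
  obtain ⟨I, hI, hC⟩ := exists_common_index (X := X)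
  have hcount : ∀ j, (F \ U j).Countable := by
    refine fun j => countable_of_isClosed_of_isolated (hF.sdiff (hU j)) fun x hx => ?_
    obtain ⟨V, hV, hVx⟩ := hiso x hx.1 fun h => hx.2 (hGU j h)
    refine ⟨V, hV, Set.Subset.antisymm (fun y hy => hVx.le ⟨hy.1, hy.2.1⟩) ?_⟩
    rintro y rfl
    exact ⟨(hVx.ge rfl : y ∈ V ∩ F).1, hx⟩
  choose W hW hCW hyW using fun j => hC _ (hcount j)
  refine ⟨J × I, fun p => U p.1 ∪ W p.1 p.2, ?_, fun p => (hU _).union (hW _ _), ?_, ?_⟩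
  · rw [Cardinal.mk_prod, Cardinal.lift_id, Cardinal.lift_id]
    exact Cardinal.mul_le_of_le aleph0_lt_dominatingNumber.le hJ hI
  · rintro ⟨j, i⟩ x hx
    by_cases h : x ∈ U j
    · exact Or.inl h
    · exact Or.inr (hCW j i ⟨hx, h⟩)
  · intro y hy
    obtain ⟨j, hj⟩ := hyU y fun h => hy (hGF h)
    obtain ⟨i, hi⟩ := hyW j y fun h => hy h.1
    exact ⟨(j, i), fun h => h.elim hj hi⟩

theorem hasSmallPseudocharacter_iteratedDerivedSet [T1Space X] [FirstCountableTopology X]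
    [LindelofSpace X] {m : Ordinal.{u}} (n : ℕ) (h : (Set.univ : Set X)ᵈ[m + n] = ∅) :
    HasSmallPseudocharacter (Set.univ : Set X)ᵈ[m] := by
  induction n generalizing m with
  | zero =>
    rw [Nat.cast_zero, add_zero] at h
    rw [h]
    obtain ⟨I, hI, hC⟩ := exists_common_index (X := X)
    obtain ⟨U, hU⟩ := hC ∅ Set.countable_empty
    exact ⟨I, U, hI, hU⟩
  | succ n ih =>
    refine HasSmallPseudocharacter.of_derived (G := (Set.univ : Set X)ᵈ[m + 1])
      (isClosed_iteratedDerivedSet_univ _) (fun x hx hx' => ?_)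
      (CantorBendixson.iteratedDerivedSet_antitone _ le_self_add) (ih ?_)
    · rw [mem_iteratedDerivedSet_add_one] at hx'
      push Not at hx'
      obtain ⟨U, hU, hxU, hUx⟩ := hx' hx
      refine ⟨U, hU, Set.Subset.antisymm (fun y hy => hUx y hy.1 hy.2) ?_⟩
      rintro y rfl
      exact ⟨hxU, hx⟩
    · rw [← h, add_assoc, Nat.cast_succ, ← Nat.cast_one, ← Nat.cast_add, ← Nat.cast_add,
        add_comm 1 n]

/-- If `X` has height `m + n` with `n` finite, then the complement of the `m`-th derived set is a
union of at most `𝔡` closed sets, each of which has height below `m` if `m` has uncountable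
cofinality. -/
theorem cof_le_of_scatteredHeight_eq_add [T1Space X] [FirstCountableTopology X]
    [LindelofSpace X] (hX : IsScatteredSpace X) {m : Ordinal.{u}} {n : ℕ}
    (h : scatteredHeight X = m + n) : m.cof ≤ Cardinal.lift.{u} dominatingNumber := by
  by_contra! hlt
  have hm : Cardinal.aleph0 < m.cof :=
    lt_of_le_of_lt (by simpa using aleph0_lt_dominatingNumber.le) hlt
  have hlim : Order.IsSuccLimit m := Ordinal.one_lt_cof_iff.1 (Cardinal.one_lt_aleph0.trans hm)
  obtain ⟨J, U, hJ, hU, hDU, hyU⟩ := hasSmallPseudocharacter_iteratedDerivedSet (X := X) (m := m) n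
    (iteratedDerivedSet_eq_empty hX h.le)
  choose a ham ha using fun j => exists_disjoint_iteratedDerivedSet hm (hU j).isClosed_compl
    (Set.disjoint_left.2 fun x hx hx' => hx (hDU j hx'))
  obtain ⟨b, hb, hab⟩ := exists_bound_of_lift_mk_lt_cof ((Cardinal.lift_le.2 hJ).trans_lt hlt) a ham
  obtain ⟨x, hx, hx'⟩ := (lt_scatteredHeight_iff hX b).1 (hb.trans_le (h ▸ le_self_add))
  have hxm : x ∉ (Set.univ : Set X)ᵈ[m] := fun hxm => hx'
    (CantorBendixson.iteratedDerivedSet_antitone _ (hlim.add_one_lt hb).le hxm)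
  obtain ⟨j, hj⟩ := hyU x hxm
  exact Set.disjoint_left.1 (ha j) hj (CantorBendixson.iteratedDerivedSet_antitone _ (hab j) hx)

end Necessary

/-! ### Gluing limit points to a topological sum -/

/-- Every scattered space carries a rank function of which every point is a strict local maximum
and whose values are below the scattered height. -/
theorem exists_rank {X : Type u} [TopologicalSpace X] (hX : IsScatteredSpace X) :
    ∃ r : X → Ordinal.{u}, (∀ x, r x < scatteredHeight X) ∧
      ∀ x, ∃ U, IsOpen U ∧ x ∈ U ∧ ∀ y ∈ U, y ≠ x → r y < r x := by
  have h : ∀ x : X, ∃ a, x ∈ (Set.univ : Set X)ᵈ[a] ∧ x ∉ (Set.univ : Set X)ᵈ[a + 1] := by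
    intro x
    have hne : {b : Ordinal.{u} | x ∉ (Set.univ : Set X)ᵈ[b]}.Nonempty :=
      ⟨scatteredHeight X, by simp [iteratedDerivedSet_eq_empty hX le_rfl]⟩
    have hmin : ∀ b < sInf {b : Ordinal.{u} | x ∉ (Set.univ : Set X)ᵈ[b]},
        x ∈ (Set.univ : Set X)ᵈ[b] := fun b hb => not_not.1 (notMem_of_lt_csInf' hb)
    have hmem := csInf_mem hne
    generalize sInf {b : Ordinal.{u} | x ∉ (Set.univ : Set X)ᵈ[b]} = c at hmem hmin
    induction c using Ordinal.limitRecOn with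
    | zero => simp at hmem
    | add_one c _ => exact ⟨c, hmin c (lt_add_one c), hmem⟩
    | limit c hc _ => exact absurd ((mem_iteratedDerivedSet_limit hc).2 hmin) hmem
  choose r hr hr' using h
  refine ⟨r, fun x => (lt_scatteredHeight_iff hX _).2 ⟨x, hr x, hr' x⟩, fun x => ?_⟩
  have hx := hr' x
  rw [mem_iteratedDerivedSet_add_one] at hx
  push Not at hx
  obtain ⟨U, hU, hxU, hUx⟩ := hx (hr x)
  refine ⟨U, hU, hxU, fun y hy hne => ?_⟩
  by_contra! hle
  exact hne (hUx y hy (CantorBendixson.iteratedDerivedSet_antitone _ hle (hr y)))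

/-- Data for attaching a countable set `Q` of limit points to a topological sum indexed by `A`:
each `q : Q` has a decreasing sequence `nbhd q` of sets of indices, which serve as its punctured
neighbourhoods. The last two fields say that `q` is separated from every index, and that every
neighbourhood of `Q` contains all but countably many indices. -/
structure GluingSystem (A Q : Type) where
  nbhd : Q → ℕ → Set A
  antitone : ∀ q, Antitone (nbhd q)
  disjoint : ∀ q q', q ≠ q' → ∃ m, Disjoint (nbhd q m) (nbhd q' m)
  notMem : ∀ q a, ∃ m, a ∉ nbhd q m
  concentrated : ∀ f : Q → ℕ, {a | ∀ q, a ∉ nbhd q (f q)}.Countable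

/-- The sum of the spaces `Z a` together with the points of `Q`; the gluing system enters through
the topology only. -/
def GluingSystem.Glued {A Q : Type} (_ : GluingSystem A Q) (Z : A → Type u) : Type u :=
  (Σ a, Z a) ⊕ Q

namespace GluingSystem

variable {A Q : Type} (G : GluingSystem A Q) (Z : A → Type u)

variable {Z} in
/-- The inclusion of the topological sum. -/
def inl (p : Σ a, Z a) : G.Glued Z := Sum.inl p

/-- The inclusion of the set of attached points. -/
def inr (q : Q) : G.Glued Z := Sum.inr q

theorem inl_injective : Function.Injective (G.inl (Z := Z)) := Sum.inl_injective

/-- The basic neighbourhoods of the attached points. -/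
def basic (q : Q) (m : ℕ) : Set (G.Glued Z) :=
  {G.inr Z q} ∪ G.inl '' {p | p.1 ∈ G.nbhd q m}

variable {G Z}

theorem inl_ne_inr (p : Σ a, Z a) (q : Q) : G.inl p ≠ G.inr Z q := Sum.inl_ne_inr

theorem inl_mem_basic {p : Σ a, Z a} {q : Q} {m : ℕ} :
    G.inl p ∈ G.basic Z q m ↔ p.1 ∈ G.nbhd q m := by
  constructor
  · rintro (h | ⟨p', hp', h⟩)
    · exact absurd h (inl_ne_inr p q)
    · rwa [← G.inl_injective Z h]
  · exact fun h => Or.inr ⟨p, h, rfl⟩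

theorem inr_mem_basic {q q' : Q} {m : ℕ} : G.inr Z q' ∈ G.basic Z q m ↔ q' = q := by
  constructor
  · rintro (h | ⟨p', -, h⟩)
    · exact Sum.inr_injective h
    · exact absurd h (inl_ne_inr p' q')
  · rintro rfl
    exact Or.inl rfl

theorem inl_mk_injective (a : A) : Function.Injective fun z : Z a => G.inl ⟨a, z⟩ :=
  (G.inl_injective Z).comp sigma_mk_injective

theorem uncountable_glued [Uncountable A] (hZ : ∀ a, Nonempty (Z a)) : Uncountable (G.Glued Z) :=
  have : Function.Injective fun a => G.inl ⟨a, (hZ a).some⟩ := fun _ _ h =>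
    congrArg Sigma.fst (G.inl_injective Z h)
  this.uncountable

variable [∀ a, TopologicalSpace (Z a)]

instance : TopologicalSpace (G.Glued Z) where
  IsOpen U := IsOpen (G.inl ⁻¹' U) ∧ ∀ q, G.inr Z q ∈ U →
    ∃ m, ∀ a ∈ G.nbhd q m, ∀ z : Z a, G.inl ⟨a, z⟩ ∈ U
  isOpen_univ := ⟨isOpen_univ, fun _ _ => ⟨0, fun _ _ _ => trivial⟩⟩
  isOpen_inter U V hU hV := ⟨hU.1.inter hV.1, fun q hq => by
    obtain ⟨m, hm⟩ := hU.2 q hq.1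
    obtain ⟨n, hn⟩ := hV.2 q hq.2
    exact ⟨max m n, fun a ha z => ⟨hm a (G.antitone q (le_max_left _ _) ha) z,
      hn a (G.antitone q (le_max_right _ _) ha) z⟩⟩⟩
  isOpen_sUnion S hS := ⟨by
    rw [Set.preimage_sUnion]
    exact isOpen_biUnion fun U hU => (hS U hU).1, fun q ⟨U, hU, hq⟩ => by
      obtain ⟨m, hm⟩ := (hS U hU).2 q hq
      exact ⟨m, fun a ha z => ⟨U, hU, hm a ha z⟩⟩⟩

theorem isOpen_iff {U : Set (G.Glued Z)} : IsOpen U ↔ IsOpen (G.inl ⁻¹' U) ∧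
    ∀ q, G.inr Z q ∈ U → ∃ m, ∀ a ∈ G.nbhd q m, ∀ z : Z a, G.inl ⟨a, z⟩ ∈ U := Iff.rfl

theorem isOpenEmbedding_inl : Topology.IsOpenEmbedding (G.inl (Z := Z)) := by
  refine .of_continuous_injective_isOpenMap ⟨fun U hU => (isOpen_iff.1 hU).1⟩
    (G.inl_injective Z) fun V hV => isOpen_iff.2 ⟨?_, ?_⟩
  · rwa [Set.preimage_image_eq _ (G.inl_injective Z)]
  · rintro q ⟨p, -, hp⟩
    exact absurd hp (inl_ne_inr p q)

theorem isOpen_basic (q : Q) (m : ℕ) : IsOpen (G.basic Z q m) := by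
  refine isOpen_iff.2 ⟨isOpen_sigma_iff.2 fun a => ?_, fun q' hq' => ⟨m, fun a ha z => ?_⟩⟩
  · by_cases h : a ∈ G.nbhd q m
    · convert isOpen_univ
      exact Set.eq_univ_of_forall fun z => inl_mem_basic.2 h
    · convert isOpen_empty
      exact Set.eq_empty_of_forall_notMem fun z hz => h (inl_mem_basic.1 hz)
  · rw [inr_mem_basic] at hq'
    exact inl_mem_basic.2 (hq' ▸ ha)

theorem nhds_inr_hasBasis (q : Q) : (nhds (G.inr Z q)).HasBasis (fun _ => True) (G.basic Z q) := by
  refine ⟨fun V => ⟨fun hV => ?_, ?_⟩⟩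
  · obtain ⟨U, hUV, hU, hqU⟩ := mem_nhds_iff.1 hV
    obtain ⟨m, hm⟩ := (isOpen_iff.1 hU).2 q hqU
    refine ⟨m, trivial, fun x hx => hUV ?_⟩
    rcases hx with rfl | ⟨⟨a, z⟩, ha, rfl⟩
    · exact hqU
    · exact hm a ha z
  · rintro ⟨m, -, hm⟩
    exact Filter.mem_of_superset ((isOpen_basic q m).mem_nhds (inr_mem_basic.2 rfl)) hm

theorem t2Space (hZ : ∀ a, T2Space (Z a)) : T2Space (G.Glued Z) := by
  have key : ∀ (p : Σ a, Z a) (q : Q), ∃ U V : Set (G.Glued Z),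
      IsOpen U ∧ IsOpen V ∧ G.inl p ∈ U ∧ G.inr Z q ∈ V ∧ Disjoint U V := by
    rintro ⟨a, z⟩ q
    obtain ⟨m, hm⟩ := G.notMem q a
    refine ⟨G.inl '' Set.range (Sigma.mk a), G.basic Z q m,
      isOpenEmbedding_inl.isOpenMap _ isOpen_range_sigmaMk, isOpen_basic q m,
      ⟨_, ⟨z, rfl⟩, rfl⟩, inr_mem_basic.2 rfl, Set.disjoint_left.2 ?_⟩
    rintro _ ⟨_, ⟨z', rfl⟩, rfl⟩ h
    exact hm (inl_mem_basic.1 h)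
  refine ⟨fun x y hxy => ?_⟩
  rcases x with p | q <;> rcases y with p' | q'
  · obtain ⟨U, V, hU, hV, hpU, hpV, hUV⟩ := t2_separation (fun h => hxy (congrArg Sum.inl h))
    exact ⟨G.inl '' U, G.inl '' V, isOpenEmbedding_inl.isOpenMap U hU,
      isOpenEmbedding_inl.isOpenMap V hV, ⟨p, hpU, rfl⟩, ⟨p', hpV, rfl⟩,
      (Set.disjoint_image_iff (G.inl_injective Z)).2 hUV⟩
  · exact key p q'
  · obtain ⟨U, V, hU, hV, hpU, hpV, hUV⟩ := key p' q
    exact ⟨V, U, hV, hU, hpV, hpU, hUV.symm⟩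
  · have hne : q ≠ q' := fun h => hxy (congrArg Sum.inr h)
    obtain ⟨m, hm⟩ := G.disjoint q q' hne
    refine ⟨G.basic Z q m, G.basic Z q' m, isOpen_basic q m, isOpen_basic q' m,
      inr_mem_basic.2 rfl, inr_mem_basic.2 rfl, Set.disjoint_left.2 ?_⟩
    rintro (p | q'') h h'
    · exact Set.disjoint_left.1 hm (inl_mem_basic.1 h) (inl_mem_basic.1 h')
    · exact hne ((inr_mem_basic.1 h).symm.trans (inr_mem_basic.1 h'))

theorem firstCountableTopology (hZ : ∀ a, FirstCountableTopology (Z a)) :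
    FirstCountableTopology (G.Glued Z) := by
  refine ⟨fun x => ?_⟩
  rcases x with ⟨a, z⟩ | q
  · have : nhds (G.inl ⟨a, z⟩) = Filter.map G.inl (Filter.map (Sigma.mk a) (nhds z)) := by
      rw [← Sigma.nhds_mk, isOpenEmbedding_inl.map_nhds_eq]
    exact this ▸ inferInstance
  · exact (nhds_inr_hasBasis q).isCountablyGenerated

theorem lindelofSpace [Countable Q] (hZ : ∀ a, LindelofSpace (Z a)) :
    LindelofSpace (G.Glued Z) := by
  refine ⟨isLindelof_of_countable_subcover fun {ι} U hU hcov => ?_⟩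
  choose i hi using fun q : Q => Set.mem_iUnion.1 (hcov (Set.mem_univ (G.inr Z q)))
  choose m hm using fun q => (isOpen_iff.1 (hU (i q))).2 q (hi q)
  choose t ht htU using fun a => (isLindelof_range (isOpenEmbedding_inl.continuous.comp
    (continuous_sigmaMk (σ := Z) (i := a))) : IsLindelof (Set.range (G.inl ∘ Sigma.mk a))
      ).elim_countable_subcover U hU ((Set.subset_univ _).trans hcov)
  refine ⟨Set.range i ∪ ⋃ a ∈ {a | ∀ q, a ∉ G.nbhd q (m q)}, t a,
    (Set.countable_range i).union ((G.concentrated m).biUnion fun a _ => ht a), ?_⟩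
  rintro (⟨a, z⟩ | q) -
  · by_cases h : ∀ q, a ∉ G.nbhd q (m q)
    · obtain ⟨j, hj, hx⟩ := Set.mem_iUnion₂.1 (htU a ⟨z, rfl⟩)
      exact Set.mem_iUnion₂.2 ⟨j, Or.inr (Set.mem_iUnion₂.2 ⟨a, h, hj⟩), hx⟩
    · push Not at h
      obtain ⟨q, hq⟩ := h
      exact Set.mem_iUnion₂.2 ⟨i q, Or.inl ⟨q, rfl⟩, hm q a hq z⟩
  · exact Set.mem_iUnion₂.2 ⟨i q, Or.inl ⟨q, rfl⟩, hi q⟩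

theorem exists_glued_rank (hZ : ∀ a, IsScatteredSpace (Z a)) {m : Ordinal.{u}}
    (hm : ∀ a, scatteredHeight (Z a) ≤ m) : ∃ r : G.Glued Z → Ordinal.{u}, (∀ x, r x < m + 1) ∧
      ∀ x, ∃ U, IsOpen U ∧ x ∈ U ∧ ∀ y ∈ U, y ≠ x → r y < r x := by
  choose r hr hloc using fun a => exists_rank (hZ a)
  refine ⟨Sum.elim (fun p => r p.1 p.2) fun _ => m, ?_, ?_⟩
  · rintro (⟨a, z⟩ | q)
    · exact ((hr a z).trans_le (hm a)).trans (lt_add_one m)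
    · exact lt_add_one m
  · rintro (⟨a, z⟩ | q)
    · obtain ⟨U, hU, hzU, hlt⟩ := hloc a z
      refine ⟨G.inl '' (Sigma.mk a '' U),
        isOpenEmbedding_inl.isOpenMap _ (isOpenMap_sigmaMk U hU), ⟨_, ⟨z, hzU, rfl⟩, rfl⟩, ?_⟩
      rintro _ ⟨_, ⟨y, hy, rfl⟩, rfl⟩ hne
      exact hlt y hy fun h => hne (h ▸ rfl)
    · refine ⟨G.basic Z q 0, isOpen_basic q 0, inr_mem_basic.2 rfl, ?_⟩
      rintro (⟨a, z⟩ | q') hy hne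
      · exact (hr a z).trans_le (hm a)
      · exact absurd (congrArg Sum.inr (inr_mem_basic.1 hy)) hne

theorem isFLSSpace [Countable Q] (hZ : ∀ a, IsFLSSpace (Z a)) {m : Ordinal.{u}}
    (hm : ∀ a, scatteredHeight (Z a) ≤ m) : IsFLSSpace (G.Glued Z) where
  hausdorff := t2Space fun a => (hZ a).hausdorff
  firstCountable := firstCountableTopology fun a => (hZ a).firstCountable
  lindelof := lindelofSpace fun a => (hZ a).lindelof
  scattered :=
    have ⟨_, _, h⟩ := exists_glued_rank (G := G) (fun a => (hZ a).scattered) hm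
    isScatteredSpace_of_rank h

theorem scatteredHeight_glued_le (hZ : ∀ a, IsScatteredSpace (Z a)) {m : Ordinal.{u}}
    (hm : ∀ a, scatteredHeight (Z a) ≤ m) : scatteredHeight (G.Glued Z) ≤ m + 1 :=
  have ⟨_, h, h'⟩ := exists_glued_rank (G := G) hZ hm
  scatteredHeight_le_of_rank h' h

theorem continuous_inl_mk (a : A) : Continuous fun z : Z a => G.inl ⟨a, z⟩ :=
  isOpenEmbedding_inl.continuous.comp continuous_sigmaMk

theorem le_scatteredHeight_glued (hZ : ∀ a, IsScatteredSpace (Z a))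
    (hG : IsScatteredSpace (G.Glued Z)) (a : A) :
    scatteredHeight (Z a) ≤ scatteredHeight (G.Glued Z) :=
  scatteredHeight_le_of_injective (hZ a) hG (continuous_inl_mk a) (inl_mk_injective a)

end GluingSystem

/-! ### Raising the height by one -/

/-- A single point which is the limit of a sequence of indices. -/
def sequenceGluing : GluingSystem ℕ Unit where
  nbhd _ m := Set.Ici m
  antitone _ _ _ h := Set.Ici_subset_Ici.2 h
  disjoint _ _ h := absurd rfl h
  notMem _ a := ⟨a + 1, by simp⟩
  concentrated f := Set.to_countable _

theorem exists_isFLSSpace_add_one {X : Type u} [TopologicalSpace X] (hX : IsFLSSpace X)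
    [Uncountable X] : ∃ (Y : Type u) (_ : TopologicalSpace Y),
      IsFLSSpace Y ∧ Uncountable Y ∧ scatteredHeight Y = scatteredHeight X + 1 := by
  let Y := sequenceGluing.Glued fun _ => X
  have hY : IsFLSSpace Y := GluingSystem.isFLSSpace (fun _ => hX) fun _ => le_rfl
  refine ⟨Y, inferInstance, hY,
    (GluingSystem.inl_mk_injective (G := sequenceGluing) (Z := fun _ => X) 0).uncountable,
    (GluingSystem.scatteredHeight_glued_le (fun _ => hX.scattered) fun _ => le_rfl).antisymm
      (Order.add_one_le_of_lt ((lt_scatteredHeight_iff_nonempty hY.scattered).2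
        ⟨sequenceGluing.inr _ (), ?_⟩))⟩
  -- The attached point is a limit of copies of each point of `X`.
  suffices h : ∀ a ≤ scatteredHeight X, sequenceGluing.inr _ () ∈ (Set.univ : Set Y)ᵈ[a] from
    h _ le_rfl
  intro a
  induction a using Ordinal.limitRecOn with
  | zero => simp
  | add_one a ih =>
    intro ha
    have ha' := Order.add_one_le_iff.1 ha
    refine mem_iteratedDerivedSet_add_one.2 ⟨ih ha'.le, fun U hU hq => ?_⟩
    obtain ⟨z, hz⟩ := (lt_scatteredHeight_iff_nonempty hX.scattered).1 ha'
    obtain ⟨m, hm⟩ := (GluingSystem.isOpen_iff.1 hU).2 () hq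
    exact ⟨_, hm m (Set.mem_Ici.2 le_rfl) z, map_mem_iteratedDerivedSet
      (GluingSystem.continuous_inl_mk (G := sequenceGluing) (Z := fun _ => X) m)
      (GluingSystem.inl_mk_injective (G := sequenceGluing) (Z := fun _ => X) m) a z hz,
      GluingSystem.inl_ne_inr _ _⟩
  | limit a ha ih =>
    exact fun hle => (mem_iteratedDerivedSet_limit ha).2 fun b hb => ih b hb (hb.le.trans hle)

/-! ### Gluing along a `𝒦`-Lusin set -/

/-- The branches of a finitely branching tree lie in a compact set. -/
theorem exists_isCompact_branches (f : List ℕ → ℕ) :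
    ∃ K : Set (ℕ → ℕ), IsCompact K ∧ {x : ℕ → ℕ | ∀ n, x n < f (PiNat.res x n)} ⊆ K := by
  have hfin : ∀ n, {s | ∃ x : ℕ → ℕ, (∀ n, x n < f (PiNat.res x n)) ∧ PiNat.res x n = s}.Finite := by
    intro n
    induction n with
    | zero =>
      refine (Set.finite_singleton []).subset ?_
      rintro _ ⟨x, -, rfl⟩
      simp
    | succ n ih =>
      refine (ih.biUnion fun s _ => (Set.finite_Iio (f s)).image fun k => k :: s).subset ?_
      rintro _ ⟨x, hx, rfl⟩
      exact Set.mem_iUnion₂.2 ⟨PiNat.res x n, ⟨x, hx, rfl⟩, x n, hx n, (PiNat.res_succ x n).symm⟩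
  exact ⟨Set.univ.pi fun n => ⋃ s ∈ {s | ∃ x : ℕ → ℕ,
      (∀ n, x n < f (PiNat.res x n)) ∧ PiNat.res x n = s}, Set.Iio (f s),
    isCompact_univ_pi fun n => ((hfin n).biUnion fun s _ => Set.finite_Iio (f s)).isCompact,
    fun x hx n _ => Set.mem_iUnion₂.2 ⟨PiNat.res x n, ⟨x, hx, rfl⟩, hx n⟩⟩

/-- The finite sequences as limit points of a `𝒦`-Lusin set: the `m`-th punctured neighbourhood of
`s` consists of the `x` which extend `s` and whose next value is at least `m`. Finite sequences are
listed in reverse, as in `PiNat.res`. -/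
def lusinGluing {L : Set (ℕ → ℕ)} (hL : IsKLusin L) : GluingSystem L (List ℕ) where
  nbhd s m := {x | PiNat.res x.1 s.length = s ∧ m ≤ x.1 s.length}
  antitone _ _ _ h _ hx := ⟨hx.1, h.trans hx.2⟩
  disjoint := by
    -- If `s` is a proper initial segment of `s'`, then `s'` prescribes the value after `s`.
    have key : ∀ s s' : List ℕ, s.length < s'.length → ∃ m, Disjoint
        {x : L | PiNat.res x.1 s.length = s ∧ m ≤ x.1 s.length}
        {x : L | PiNat.res x.1 s'.length = s' ∧ m ≤ x.1 s'.length} := by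
      intro s s' hlt
      by_cases h : ∃ y : ℕ → ℕ, PiNat.res y s'.length = s'
      · obtain ⟨y, hy⟩ := h
        refine ⟨y s.length + 1, Set.disjoint_left.2 fun x hx hx' => ?_⟩
        have := PiNat.res_eq_res.1 (hx'.1.trans hy.symm) hlt
        have := hx.2
        omega
      · exact ⟨0, Set.disjoint_left.2 fun x _ hx' => h ⟨x.1, hx'.1⟩⟩
    intro s s' hne
    rcases lt_trichotomy s.length s'.length with h | h | h
    · exact key s s' h
    · exact ⟨0, Set.disjoint_left.2 fun x hx hx' => hne (by rw [← hx.1, ← hx'.1, h])⟩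
    · obtain ⟨m, hm⟩ := key s' s h
      exact ⟨m, hm.symm⟩
  notMem s x := ⟨x.1 s.length + 1, fun h => absurd h.2 (by omega)⟩
  concentrated f := by
    obtain ⟨K, hK, hsub⟩ := exists_isCompact_branches f
    refine ((hL K hK).preimage Subtype.val_injective).mono fun x hx => ?_
    refine ⟨hsub fun n => ?_, x.2⟩
    by_contra! hle
    exact hx (PiNat.res x.1 n) ⟨by rw [PiNat.res_length], by rwa [PiNat.res_length]⟩

theorem uncountable_of_mk_eq_dominatingNumber {L : Set (ℕ → ℕ)} (hc : #L = dominatingNumber) :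
    Uncountable L := by
  rw [← Cardinal.aleph0_lt_mk_iff, hc]
  exact aleph0_lt_dominatingNumber

theorem exists_isFLSSpace_two
    (hL : ∃ L : Set (ℕ → ℕ), IsKLusin L ∧ #L = dominatingNumber) :
    ∃ (X : Type u) (_ : TopologicalSpace X),
      IsFLSSpace X ∧ Uncountable X ∧ scatteredHeight X = 2 := by
  obtain ⟨L, hL, hc⟩ := hL
  have := uncountable_of_mk_eq_dominatingNumber hc
  let X := (lusinGluing hL).Glued fun _ => PUnit.{u + 1}
  have hr : ∀ x : PUnit.{u + 1}, ∃ U, IsOpen U ∧ x ∈ U ∧ ∀ y ∈ U, y ≠ x → (0 : Ordinal.{u}) < 0 :=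
    fun x => ⟨Set.univ, isOpen_univ, trivial, fun y _ h => absurd rfl h⟩
  have hs : IsScatteredSpace PUnit.{u + 1} := isScatteredSpace_of_rank hr
  have h1 : scatteredHeight PUnit.{u + 1} ≤ 1 := scatteredHeight_le_of_rank hr fun _ => zero_lt_one
  have hX : IsFLSSpace X :=
    GluingSystem.isFLSSpace (fun _ => ⟨inferInstance, inferInstance, inferInstance, hs⟩) fun _ => h1
  have hunc : Uncountable X := GluingSystem.uncountable_glued fun _ => inferInstance
  have := hX.lindelof
  refine ⟨X, inferInstance, hX, hunc, le_antisymm ?_ (two_le_scatteredHeight hX.scattered)⟩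
  rw [← one_add_one_eq_two]
  exact GluingSystem.scatteredHeight_glued_le (fun _ => hs) fun _ => h1

/-- Spaces of heights cofinal in `m`, one for each point of a `𝒦`-Lusin set, are glued to a space
whose height is `m` or `m + 1`. Since `m` has uncountable cofinality, it is `m + 1`. -/
theorem exists_isFLSSpace_add_one_of_cof
    (hL : ∃ L : Set (ℕ → ℕ), IsKLusin L ∧ #L = dominatingNumber) {m : Ordinal.{u}}
    (hm : Cardinal.aleph0 < m.cof) (hmd : m.cof ≤ Cardinal.lift.{u} dominatingNumber)
    (h : ∀ b < m, ∃ (X : Type u) (_ : TopologicalSpace X),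
      IsFLSSpace X ∧ b ≤ scatteredHeight X ∧ scatteredHeight X < m) :
    ∃ (X : Type u) (_ : TopologicalSpace X),
      IsFLSSpace X ∧ Uncountable X ∧ scatteredHeight X = m + 1 := by
  obtain ⟨L, hL, hc⟩ := hL
  have := uncountable_of_mk_eq_dominatingNumber hc
  have hlim : Order.IsSuccLimit m := Ordinal.one_lt_cof_iff.1 (Cardinal.one_lt_aleph0.trans hm)
  obtain ⟨g, hgm, hg⟩ : ∃ g : L → Ordinal.{u}, (∀ x, g x < m) ∧ ∀ b < m, ∃ x, b ≤ g x := by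
    obtain ⟨s, hs, hsc⟩ := Order.exists_cof_eq m.ToType
    rw [Ordinal.cof_toType] at hsc
    have hle : Cardinal.lift.{0} #s ≤ Cardinal.lift.{u} #L := by
      rw [hsc, hc, Cardinal.lift_id']
      exact hmd
    obtain ⟨e⟩ := Cardinal.lift_mk_le'.1 hle
    have hsne : Nonempty s := by
      obtain ⟨y, hy, -⟩ := hs (Ordinal.ToType.mk ⟨0, hlim.bot_lt⟩)
      exact ⟨⟨y, hy⟩⟩
    refine ⟨fun x => (Ordinal.ToType.mk.symm (Function.invFun e x).1 : Ordinal),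
      fun x => (Ordinal.ToType.mk.symm _).2, fun b hb => ?_⟩
    obtain ⟨y, hy, hby⟩ := hs (Ordinal.ToType.mk ⟨b, hb⟩)
    refine ⟨e ⟨y, hy⟩, ?_⟩
    beta_reduce
    rw [Function.leftInverse_invFun e.injective]
    have := Ordinal.ToType.mk.symm.monotone hby
    rw [OrderIso.symm_apply_apply] at this
    exact this
  choose Z tZ hZ hgZ hZm using fun x => h (g x + 1) (hlim.add_one_lt (hgm x))
  let X := (lusinGluing hL).Glued Z
  have hX : IsFLSSpace X := GluingSystem.isFLSSpace hZ fun a => (hZm a).le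
  have := hX.lindelof
  have hlt : ∀ x, g x < scatteredHeight (Z x) := fun x => Order.add_one_le_iff.1 (hgZ x)
  have hne : ∀ x, Nonempty (Z x) := fun x =>
    have ⟨z, _⟩ := (lt_scatteredHeight_iff_nonempty (hZ x).scattered).1 (hlt x)
    ⟨z⟩
  refine ⟨X, inferInstance, hX, GluingSystem.uncountable_glued hne, le_antisymm
    (GluingSystem.scatteredHeight_glued_le (fun x => (hZ x).scattered) fun x => (hZm x).le)
    (Order.add_one_le_of_lt (lt_of_le_of_ne (le_of_forall_lt fun b hb => ?_) fun heq => ?_))⟩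
  · obtain ⟨x, hx⟩ := hg b hb
    exact hx.trans_lt ((hlt x).trans_le
      (GluingSystem.le_scatteredHeight_glued (fun x => (hZ x).scattered) hX.scattered x))
  · exact hm.not_ge (heq ▸ cof_scatteredHeight_le hX.scattered)

/-! ### A partition of the real line into Bernstein sets -/

/-- Continuum many sets of cardinality continuum have an injective choice function. -/
theorem exists_injective_choice {T R : Type} (hT : #T ≤ Cardinal.continuum) (S : T → Set R)
    (hS : ∀ t, Cardinal.continuum ≤ #(S t)) :
    ∃ p : T → R, Function.Injective p ∧ ∀ t, p t ∈ S t := by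
  classical
  obtain ⟨lt, hwo, hord⟩ := Cardinal.exists_ord_eq T
  have hlt : ∀ t (q : {s // lt s t} → R), (S t \ Set.range q).Nonempty := by
    intro t q
    refine Set.nonempty_iff_ne_empty.2 fun h => ?_
    have h1 : #(S t) ≤ #{s // lt s t} :=
      (Cardinal.mk_le_mk_of_subset (Set.sdiff_eq_empty.1 h)).trans Cardinal.mk_range_le
    have h2 : #{s // lt s t} < #T := Cardinal.card_typein_lt (r := lt) t hord
    exact (((hS t).trans h1).trans_lt h2).not_ge hT
  let p : T → R := hwo.wf.fix fun t ih => (hlt t fun s => ih s.1 s.2).some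
  have hp : ∀ t, p t ∈ S t \ Set.range fun s : {s // lt s t} => p s.1 := by
    intro t
    have : p t = (hlt t fun s => p s.1).some := hwo.wf.fix_eq _ t
    rw [this]
    exact (hlt t fun s => p s.1).some_mem
  refine ⟨p, fun s t hst => ?_, fun t => (hp t).1⟩
  rcases trichotomous_of lt s t with h | h | h
  · exact absurd ⟨⟨s, h⟩, hst⟩ (hp t).2
  · exact h
  · exact absurd ⟨⟨t, h⟩, hst.symm⟩ (hp s).2

theorem mk_setOf_isClosed_real_le : #{C : Set ℝ | IsClosed C} ≤ Cardinal.continuum := by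
  have h := MeasurableSpace.cardinal_measurableSet_le_continuum (s := ⋃ a : ℚ, {Set.Iio (a : ℝ)})
    ((Cardinal.le_aleph0_iff_set_countable.2 (Set.countable_iUnion fun _ =>
      Set.countable_singleton _)).trans Cardinal.aleph0_le_continuum)
  rw [← Real.borel_eq_generateFrom_Iio_rat] at h
  refine (Cardinal.mk_le_mk_of_subset fun C hC => ?_).trans h
  borelize ℝ
  exact IsClosed.measurableSet hC

theorem continuum_le_mk_of_isClosed {C : Set ℝ} (hC : IsClosed C) (hunc : ¬ C.Countable) :
    Cardinal.continuum ≤ #C := by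
  obtain ⟨f, hf, -, hinj⟩ := hC.exists_nat_bool_injection_of_not_countable hunc
  have : #(ℕ → Bool) ≤ #C := Cardinal.mk_le_of_injective
    (f := fun x => (⟨f x, hf ⟨x, rfl⟩⟩ : C)) fun x y h => hinj (congrArg Subtype.val h)
  simpa using this

/-- There is a real function all of whose fibres are Bernstein sets. -/
theorem exists_bernstein_function :
    ∃ r : ℝ → ℝ, ∀ C : Set ℝ, IsClosed C → ¬ C.Countable → ∀ b, ∃ x ∈ C, r x = b := by
  let T := {C : Set ℝ // IsClosed C ∧ ¬ C.Countable} × ℝ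
  have hT : #T ≤ Cardinal.continuum := by
    rw [Cardinal.mk_prod, Cardinal.lift_id, Cardinal.lift_id, Cardinal.mk_real]
    exact Cardinal.mul_le_of_le Cardinal.aleph0_le_continuum
      ((Cardinal.mk_subtype_mono fun C hC => hC.1).trans mk_setOf_isClosed_real_le) le_rfl
  obtain ⟨p, hp, hpC⟩ := exists_injective_choice hT (fun t => t.1.1)
    fun t => continuum_le_mk_of_isClosed t.1.2.1 t.1.2.2
  have hne : Nonempty T := ⟨(⟨Set.univ, isClosed_univ, Cardinal.not_countable_real⟩, 0)⟩
  refine ⟨fun x => (Function.invFun p x).2, fun C hC hunc b =>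
    ⟨p (⟨C, hC, hunc⟩, b), hpC (⟨C, hC, hunc⟩, b), ?_⟩⟩
  beta_reduce
  rw [Function.leftInverse_invFun hp]

/-- A function from the reals onto an ordinal below `𝔠⁺` whose fibres are Bernstein sets. -/
theorem exists_bernstein_rank {l : Ordinal.{u}} (hl : 0 < l) (hc : l.card ≤ Cardinal.continuum) :
    ∃ r : ℝ → Ordinal.{u}, (∀ x, r x < l) ∧
      ∀ C : Set ℝ, IsClosed C → ¬ C.Countable → ∀ b < l, ∃ x ∈ C, r x = b := by
  obtain ⟨r, hr⟩ := exists_bernstein_function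
  have hle : Cardinal.lift.{0} #l.ToType ≤ Cardinal.lift.{u} #ℝ := by
    simpa [Cardinal.mk_real] using hc
  obtain ⟨e⟩ := Cardinal.lift_mk_le'.1 hle
  have hne : Nonempty l.ToType := ⟨Ordinal.ToType.mk ⟨0, hl⟩⟩
  refine ⟨fun x => (Ordinal.ToType.mk.symm (Function.invFun e (r x)) : Ordinal),
    fun x => (Ordinal.ToType.mk.symm _).2, fun C hC hunc b hb => ?_⟩
  obtain ⟨x, hx, hxb⟩ := hr C hC hunc (e (Ordinal.ToType.mk ⟨b, hb⟩))
  refine ⟨x, hx, ?_⟩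
  beta_reduce
  rw [hxb, Function.leftInverse_invFun e.injective, OrderIso.symm_apply_apply]

/-! ### Heights of countable cofinality -/

/-- The set `P` with a refined topology: a punctured neighbourhood of `y` consists of the points of
smaller rank in a neighbourhood of `y` in `P`. -/
def RankRefinement {P : Type} (_ : P → Ordinal.{u}) : Type u := ULift.{u} P

namespace RankRefinement

variable {P : Type} (r : P → Ordinal.{u})

/-- The point of the refinement given by a point of `P`. -/
def up (y : P) : RankRefinement r := ULift.up y

variable {r}

/-- The point of `P` underlying a point of the refinement. -/
def down (y : RankRefinement r) : P := ULift.down y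

theorem down_injective : Function.Injective (down : RankRefinement r → P) := ULift.down_injective

variable [TopologicalSpace P]

instance : TopologicalSpace (RankRefinement r) where
  IsOpen U := ∀ y ∈ U, ∃ V : Set P, IsOpen V ∧ y.down ∈ V ∧ ∀ z ∈ V, r z < r y.down → up r z ∈ U
  isOpen_univ _ _ := ⟨Set.univ, isOpen_univ, trivial, fun _ _ _ => trivial⟩
  isOpen_inter U U' hU hU' y hy := by
    obtain ⟨V, hV, hyV, h⟩ := hU y hy.1
    obtain ⟨V', hV', hyV', h'⟩ := hU' y hy.2
    exact ⟨V ∩ V', hV.inter hV', ⟨hyV, hyV'⟩, fun z hz hlt => ⟨h z hz.1 hlt, h' z hz.2 hlt⟩⟩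
  isOpen_sUnion S hS y := by
    rintro ⟨U, hU, hy⟩
    obtain ⟨V, hV, hyV, h⟩ := hS U hU y hy
    exact ⟨V, hV, hyV, fun z hz hlt => ⟨U, hU, h z hz hlt⟩⟩

theorem isOpen_iff {U : Set (RankRefinement r)} : IsOpen U ↔ ∀ y ∈ U, ∃ V : Set P,
    IsOpen V ∧ y.down ∈ V ∧ ∀ z ∈ V, r z < r y.down → up r z ∈ U := Iff.rfl

theorem continuous_down : Continuous (down : RankRefinement r → P) :=
  ⟨fun V hV => isOpen_iff.2 fun _ hy => ⟨V, hV, hy, fun _ hz _ => hz⟩⟩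

theorem isOpen_insert {V : Set P} (hV : IsOpen V) {y : RankRefinement r} (hy : y.down ∈ V) :
    IsOpen (insert y {z | z.down ∈ V ∧ r z.down < r y.down}) := by
  refine isOpen_iff.2 fun z hz => ?_
  rcases hz with rfl | ⟨hzV, hlt⟩
  · exact ⟨V, hV, hy, fun w hw hlt => Or.inr ⟨hw, hlt⟩⟩
  · exact ⟨V, hV, hzV, fun w hw hlt' => Or.inr ⟨hw, hlt'.trans hlt⟩⟩

instance [FirstCountableTopology P] : FirstCountableTopology (RankRefinement r) := by
  refine ⟨fun y => ?_⟩
  obtain ⟨B, hB, hbasis⟩ := (nhds_basis_opens y.down).exists_antitone_subbasis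
  have : (nhds y).HasBasis (fun _ : ℕ => True)
      fun n => insert y {z | z.down ∈ B n ∧ r z.down < r y.down} := by
    refine ⟨fun W => ⟨fun hW => ?_, ?_⟩⟩
    · obtain ⟨U, hUW, hU, hyU⟩ := mem_nhds_iff.1 hW
      obtain ⟨V, hV, hyV, h⟩ := isOpen_iff.1 hU y hyU
      obtain ⟨n, -, hn⟩ := hbasis.toHasBasis.mem_iff.1 (hV.mem_nhds hyV)
      refine ⟨n, trivial, Set.insert_subset (hUW hyU) fun z hz => hUW (h _ (hn hz.1) hz.2)⟩
    · rintro ⟨n, -, hn⟩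
      exact Filter.mem_of_superset ((isOpen_insert (hB n).2 (hB n).1).mem_nhds (Or.inl rfl)) hn
  exact this.isCountablyGenerated

theorem isolated_in_rank (y : RankRefinement r) :
    ∃ U, IsOpen U ∧ y ∈ U ∧ ∀ z ∈ U, z ≠ y → r z.down < r y.down :=
  ⟨_, isOpen_insert isOpen_univ trivial, Or.inl rfl,
    fun _ hz hne => (hz.resolve_left hne).2⟩

theorem scatteredHeight_eq {l : Ordinal.{u}} (hl : ∀ x, r x < l)
    (hdense : ∀ V : Set P, IsOpen V → V.Nonempty → ∀ b < l, ∃ x ∈ V, r x = b) [Nonempty P] :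
    scatteredHeight (RankRefinement r) = l := by
  refine (scatteredHeight_le_of_rank isolated_in_rank fun y => hl y.down).antisymm
    (le_of_forall_lt fun a ha => ?_)
  obtain ⟨x, -, hx⟩ := hdense Set.univ isOpen_univ Set.univ_nonempty a ha
  refine (lt_scatteredHeight_iff_nonempty (isScatteredSpace_of_rank isolated_in_rank)).2 ⟨up r x,
    mem_iteratedDerivedSet_of_le_rank (r := fun y => r y.down) (fun y U hU hy b hb => ?_) a _ hx.ge⟩
  obtain ⟨V, hV, hyV, h⟩ := isOpen_iff.1 hU y hy
  obtain ⟨z, hz, rfl⟩ := hdense V hV ⟨_, hyV⟩ b (hb.trans (hl _))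
  exact ⟨up r z, h z hz hb, rfl⟩

/-- If the fibre of rank `c` meets every uncountable closed set, then countably many neighbourhoods
of points of this fibre cover all but countably many of the points of rank below `c`. Countably
many `c` suffice if they are cofinal among the ranks. -/
theorem lindelofSpace [SecondCountableTopology P] {S : Set Ordinal.{u}} (hS : S.Countable)
    (hcof : ∀ x, ∃ c ∈ S, r x < c)
    (hfib : ∀ C : Set P, IsClosed C → ¬ C.Countable → ∀ c ∈ S, ∃ x ∈ C, r x = c) :
    LindelofSpace (RankRefinement r) := by
  refine ⟨isLindelof_of_countable_subcover fun {ι} U hU hcov => ?_⟩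
  choose i hi using fun y => Set.mem_iUnion.1 (hcov (Set.mem_univ y))
  choose V hV hyV h using fun y => isOpen_iff.1 (hU (i y)) y (hi y)
  have key : ∀ c ∈ S, ∃ t : Set ι, t.Countable ∧
      ∀ y : RankRefinement r, r y.down < c → ∃ j ∈ t, y ∈ U j := by
    intro c hc
    obtain ⟨T, hTc, hTU⟩ := TopologicalSpace.isOpen_iUnion_countable
      (fun y : {y : RankRefinement r // r y.down = c} => V y.1) fun y => hV y.1
    have hcount : (⋃ y : {y : RankRefinement r // r y.down = c}, V y.1)ᶜ.Countable := by
      by_contra hunc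
      obtain ⟨x, hx, hxc⟩ := hfib _ (isOpen_iUnion fun y => hV _).isClosed_compl hunc c hc
      exact hx (Set.mem_iUnion.2 ⟨⟨up r x, hxc⟩, hyV _⟩)
    refine ⟨(fun y : {y : RankRefinement r // r y.down = c} => i y.1) '' T ∪
      i '' (down ⁻¹' (⋃ y : {y : RankRefinement r // r y.down = c}, V y.1)ᶜ),
      (hTc.image _).union ((hcount.preimage down_injective).image i), fun y hy => ?_⟩
    by_cases hyW : y.down ∈ ⋃ y : {y : RankRefinement r // r y.down = c}, V y.1
    · rw [← hTU] at hyW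
      obtain ⟨x, hx, hyx⟩ := Set.mem_iUnion₂.1 hyW
      exact ⟨i x.1, Or.inl ⟨x, hx, rfl⟩, h x.1 _ hyx (hy.trans_eq x.2.symm)⟩
    · exact ⟨i y, Or.inr ⟨y, hyW, rfl⟩, hi y⟩
  choose! t ht htU using key
  refine ⟨⋃ c ∈ S, t c, hS.biUnion ht, fun y _ => ?_⟩
  obtain ⟨c, hc, hlt⟩ := hcof y.down
  obtain ⟨j, hj, hyj⟩ := htU c hc y hlt
  exact Set.mem_iUnion₂.2 ⟨j, Set.mem_iUnion₂.2 ⟨c, hc, hj⟩, hyj⟩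

end RankRefinement

theorem exists_isFLSSpace_of_cof_eq_aleph0 {l : Ordinal.{u}} (hcof : l.cof = Cardinal.aleph0)
    (hc : l.card ≤ Cardinal.continuum) : ∃ (X : Type u) (_ : TopologicalSpace X),
      IsFLSSpace X ∧ Uncountable X ∧ scatteredHeight X = l := by
  have hlim : Order.IsSuccLimit l :=
    Ordinal.one_lt_cof_iff.1 (hcof ▸ Cardinal.one_lt_aleph0)
  obtain ⟨r, hrl, hr⟩ := exists_bernstein_rank hlim.bot_lt hc
  obtain ⟨s, hs, hsc⟩ := Order.exists_cof_eq l.ToType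
  rw [Ordinal.cof_toType, hcof] at hsc
  refine ⟨RankRefinement r, inferInstance, ⟨?_, inferInstance, ?_,
    isScatteredSpace_of_rank RankRefinement.isolated_in_rank⟩, ?_,
    RankRefinement.scatteredHeight_eq hrl fun V hV ⟨x, hx⟩ b hb => ?_⟩
  · exact T2Space.of_injective_continuous RankRefinement.down_injective
      RankRefinement.continuous_down
  · refine RankRefinement.lindelofSpace
      (S := (fun y : l.ToType => (Ordinal.ToType.mk.symm y : Ordinal)) '' s)
      ((Cardinal.le_aleph0_iff_set_countable.1 hsc.le).image _) (fun x => ?_) ?_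
    · obtain ⟨y, hy, hle⟩ := hs (Ordinal.ToType.mk ⟨r x + 1, hlim.add_one_lt (hrl x)⟩)
      refine ⟨_, ⟨y, hy, rfl⟩, Order.add_one_le_iff.1 ?_⟩
      have := Ordinal.ToType.mk.symm.monotone hle
      rw [OrderIso.symm_apply_apply] at this
      exact this
    · rintro C hC hunc _ ⟨y, -, rfl⟩
      exact hr C hC hunc _ (Ordinal.ToType.mk.symm y).2
  · exact inferInstanceAs (Uncountable (ULift.{u} ℝ))
  · obtain ⟨ε, hε, hball⟩ := Metric.nhds_basis_closedBall.mem_iff.1 (hV.mem_nhds hx)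
    obtain ⟨y, hy, hyb⟩ := hr (Metric.closedBall x ε) Metric.isClosed_closedBall (fun hcount => by
      have := hcount.mono Metric.ball_subset_closedBall
      rw [Real.ball_eq_Ioo] at this
      exact (Cardinal.Real.Ioo_countable_iff.1 this).not_gt (by linarith)) b hb
    exact ⟨y, hball hy, hyb⟩

/-! ### The characterization -/

theorem corollary6
    (hL : ∃ L : Set (ℕ → ℕ), IsKLusin L ∧ #L = dominatingNumber)
    (l : Ordinal.{u}) :
    (∃ (X : Type u) (_ : TopologicalSpace X),
        IsFLSSpace X ∧ Uncountable X ∧ scatteredHeight X = l) ↔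
      (2 ≤ l ∧ l < (Order.succ Cardinal.continuum.{u}).ord ∧ l.cof ≤ Cardinal.aleph0 ∧
        (limitPart l).cof ≤ Cardinal.lift.{u} dominatingNumber) := by
  obtain ⟨hlim, n, hn⟩ := (eq_limitPart_iff l _).1 rfl
  constructor
  · rintro ⟨X, _, hX, hunc, rfl⟩
    have := hX.hausdorff
    have := hX.firstCountable
    have := hX.lindelof
    refine ⟨two_le_scatteredHeight hX.scattered, ?_, cof_scatteredHeight_le hX.scattered,
      cof_le_of_scatteredHeight_eq_add hX.scattered hn⟩
    rw [Cardinal.lt_ord, Order.lt_succ_iff]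
    exact (card_scatteredHeight_le hX.scattered).trans (mk_le_continuum_of_lindelof X)
  · rintro ⟨h2, hlt, hcof, hd⟩
    rw [Cardinal.lt_ord, Order.lt_succ_iff] at hlt
    generalize limitPart l = m at *
    subst hn
    have hmc : m.card ≤ Cardinal.continuum := (Ordinal.card_le_card le_self_add).trans hlt
    -- Each finite part `n ≥ k` is reached from a space of height `m + k` by adding limit points.
    have step : ∀ k : ℕ, (∃ (X : Type u) (_ : TopologicalSpace X),
        IsFLSSpace X ∧ Uncountable X ∧ scatteredHeight X = m + k) → ∀ n : ℕ, k ≤ n →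
        ∃ (X : Type u) (_ : TopologicalSpace X),
          IsFLSSpace X ∧ Uncountable X ∧ scatteredHeight X = m + n := by
      intro k hk n hkn
      induction n, hkn using Nat.le_induction with
      | base => exact hk
      | succ n _ ih =>
        obtain ⟨X, _, hX, hunc, hn⟩ := ih
        obtain ⟨Y, tY, hY, hunc', hY'⟩ := exists_isFLSSpace_add_one hX
        exact ⟨Y, tY, hY, hunc', by rw [hY', hn, Nat.cast_succ, add_assoc]⟩
    rcases eq_or_ne m 0 with rfl | hm0
    · refine step 2 ?_ n (by simpa using h2)
      simpa using exists_isFLSSpace_two hL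
    have hmlim : Order.IsSuccLimit m := by
      rcases Ordinal.zero_or_succ_or_isSuccLimit m with h | ⟨c, hc⟩ | h
      · exact absurd h hm0
      · exact absurd hc.symm (hlim c)
      · exact h
    have hmcof : Cardinal.aleph0 ≤ m.cof :=
      Ordinal.aleph0_le_cof_iff.2 (Ordinal.one_lt_cof_iff.2 hmlim)
    rcases hmcof.eq_or_lt with hw | hw
    · exact step 0 (by simpa using exists_isFLSSpace_of_cof_eq_aleph0 hw.symm hmc) n (Nat.zero_le n)
    · have hn1 : 1 ≤ n := by
        rcases Nat.eq_zero_or_pos n with rfl | h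
        · rw [Nat.cast_zero, add_zero] at hcof
          exact absurd hcof hw.not_ge
        · exact h
      refine step 1 ?_ n hn1
      rw [Nat.cast_one]
      refine exists_isFLSSpace_add_one_of_cof hL hw hd fun b hb => ?_
      -- `b + ω` has countable cofinality, so it is below `m` and is the height of a space.
      have hbcof : (b + ω).cof = Cardinal.aleph0 := by
        rw [Ordinal.cof_add b Ordinal.omega0_ne_zero, Ordinal.cof_omega0]
      have hbm : b + ω < m := by
        refine lt_of_le_of_ne ?_ fun h => hw.ne' (h ▸ hbcof)
        refine (Ordinal.add_le_iff_of_isSuccLimit Ordinal.isSuccLimit_omega0).2 fun c hc => ?_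
        obtain ⟨k, rfl⟩ := Ordinal.lt_omega0.1 hc
        exact (hmlim.add_natCast_lt hb k).le
      obtain ⟨X, tX, hX, -, hXb⟩ := exists_isFLSSpace_of_cof_eq_aleph0 hbcof
        ((Ordinal.card_le_card hbm.le).trans hmc)
      exact ⟨X, tX, hX, hXb ▸ le_self_add, hXb ▸ hbm⟩
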